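/- Let $K$ be a field (of any characteristic) and let $I\subseteq S=K[x_1,\dots,x_n]$ be a nonzero squarefree monomial ideal whose minimal monomial generators $G(I)=\{f_1,\dots,f_m\}$ all have the same degree $d\ge 1$. The $*$-linearization of $I$ is the ideal $$\mathrm{LIN}(I)=\big(x_1^{a_1}\cdots x_n^{a_n}\mid a_1+\dots+a_n=d,\ a_i\le M\text{ for all }i\big)+\big(f_jy_j/x_k\mid x_k\text{ divides }f_j,\ 1\le k\le n,\ 1\le j\le m\big)$$ of the polynomial ring $R=K[x_1,\dots,x_n,y_1,\dots,y_m]$, where $M$ is the highest exponent with which a variable occurs in $f_1,\dots,f_m$ (so $M=1$ here, as $I$ is squarefree). A $(d-1)$-edge of $I$ is a squarefree monomial of degree $d-1$ that divides some element of $G(I)$. A $j$-cluster is a set of $j$ elements of $G(I)$ that are all divided by a same $(d-1)$-edge; a $j$-cluster is maximal if it is not contained in a $(j+1)$-cluster. Let $C_j$ be the number of maximal $j$-clusters. Then $N:=\max\{j\mid C_j\neq 0\}$ exists, and $$\operatorname{pd}_R(\mathrm{LIN}(I))=n-d+N,\qquad \operatorname{depth}(R/\mathrm{LIN}(I))=m+d-N-1,$$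 where the depth is taken with respect to the irrelevant maximal ideal $(x_1,\dots,x_n,y_1,\dots,y_m)$ of $R$. -/

import Mathlib

open CategoryTheory MvPolynomial

universe u

/-! A monomial of `K[x_1, …, x_n]` is represented by its exponent vector `a : Fin n →₀ ℕ`;
`u ≤ a` then says that the monomial `u` divides the monomial `a`. -/

/-- An ideal is monomial if it is generated by the monomials it contains. -/
def IsMonomialIdeal {K : Type u} [Field K] {n : ℕ} (I : Ideal (MvPolynomial (Fin n) K)) : Prop :=
  Ideal.span {p | ∃ a : Fin n →₀ ℕ, p = monomial a 1 ∧ p ∈ I} = I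

/-- The minimal monomial generators `G(I)`: the monomials in `I` (given by their exponent vectors)
that are minimal with respect to divisibility. -/
def minimalMonomialGenerators {K : Type u} [Field K] {n : ℕ}
    (I : Ideal (MvPolynomial (Fin n) K)) : Set (Fin n →₀ ℕ) :=
  {a | Minimal (fun b : Fin n →₀ ℕ => (monomial b (1 : K)) ∈ I) a}

/-- `I` is equigenerated in degree `d`: all the minimal monomial generators have degree `d`. -/
def IsEquigenerated {K : Type u} [Field K] {n : ℕ}
    (I : Ideal (MvPolynomial (Fin n) K)) (d : ℕ) : Prop :=
  ∀ a ∈ minimalMonomialGenerators I, a.degree = d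

/-- A monomial is squarefree if all its exponents are at most `1`. -/
def IsSquarefreeMonomial {n : ℕ} (a : Fin n →₀ ℕ) : Prop :=
  ∀ i, a i ≤ 1

/-- A squarefree monomial ideal: a monomial ideal whose minimal monomial generators are
squarefree. -/
def IsSquarefreeMonomialIdeal {K : Type u} [Field K] {n : ℕ}
    (I : Ideal (MvPolynomial (Fin n) K)) : Prop :=
  IsMonomialIdeal I ∧ ∀ a ∈ minimalMonomialGenerators I, IsSquarefreeMonomial a

/-- The highest exponent `M` with which a variable occurs in `f_1, …, f_m`. -/
def maxExponent {n m : ℕ} (f : Fin m → (Fin n →₀ ℕ)) : ℕ :=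
  Finset.univ.sup fun j => Finset.univ.sup fun i => f j i

/-- The complete part of the `*`-linearization: the ideal of
`R = K[x_1, …, x_n, y_1, …, y_m]` generated by the monomials `x_1^{a_1} ⋯ x_n^{a_n}` of degree `d`
with all `a_i ≤ M`. The variables of `R` are `x_i = X (Sum.inl i)` and `y_j = X (Sum.inr j)`. -/
noncomputable def completePart (K : Type u) [Field K] {n m : ℕ} (d : ℕ)
    (f : Fin m → (Fin n →₀ ℕ)) : Ideal (MvPolynomial (Fin n ⊕ Fin m) K) :=
  Ideal.span {p | ∃ a : Fin n →₀ ℕ, a.degree = d ∧ (∀ i, a i ≤ maxExponent f) ∧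
    p = monomial (Finsupp.sumElim a 0) 1}

/-- The last part of the `*`-linearization: the ideal of `R = K[x_1, …, x_n, y_1, …, y_m]`
generated by the monomials `(f_j / x_k) y_j`, where `x_k` divides `f_j`. -/
noncomputable def lastPart (K : Type u) [Field K] {n m : ℕ}
    (f : Fin m → (Fin n →₀ ℕ)) : Ideal (MvPolynomial (Fin n ⊕ Fin m) K) :=
  Ideal.span {p | ∃ (j : Fin m) (k : Fin n), Finsupp.single k 1 ≤ f j ∧
    p = monomial (Finsupp.sumElim (f j - Finsupp.single k 1) (Finsupp.single j 1)) 1}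

/-- The `*`-linearization `LIN(I)` of the ideal `I` equigenerated in degree `d` whose minimal
monomial generators are `f_1, …, f_m`. -/
noncomputable def starLinearization (K : Type u) [Field K] {n m : ℕ} (d : ℕ)
    (f : Fin m → (Fin n →₀ ℕ)) : Ideal (MvPolynomial (Fin n ⊕ Fin m) K) :=
  completePart K d f ⊔ lastPart K f

/-- `u` is a `(d-1)`-edge of the set `G` of monomials of degree `d`: a squarefree monomial of
degree `d - 1` that divides some element of `G`. -/
def IsEdge {n : ℕ} (G : Set (Fin n →₀ ℕ)) (d : ℕ) (u : Fin n →₀ ℕ) : Prop :=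
  IsSquarefreeMonomial u ∧ u.degree + 1 = d ∧ ∃ a ∈ G, u ≤ a

/-- A `j`-cluster: a set of `j` elements of `G` that are divided by a same `(d-1)`-edge. -/
def IsCluster {n : ℕ} (G : Set (Fin n →₀ ℕ)) (d j : ℕ) (C : Finset (Fin n →₀ ℕ)) : Prop :=
  C.card = j ∧ (∀ a ∈ C, a ∈ G) ∧ ∃ u, IsEdge G d u ∧ ∀ a ∈ C, u ≤ a

/-- A maximal `j`-cluster: a `j`-cluster that is not part of a `(j+1)`-cluster. -/
def IsMaximalCluster {n : ℕ} (G : Set (Fin n →₀ ℕ)) (d j : ℕ)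
    (C : Finset (Fin n →₀ ℕ)) : Prop :=
  IsCluster G d j C ∧ ¬ ∃ C', IsCluster G d (j + 1) C' ∧ C ⊆ C'

/-- The number `C_j` of maximal `j`-clusters. -/
noncomputable def numMaximalClusters {n : ℕ} (G : Set (Fin n →₀ ℕ)) (d j : ℕ) : ℕ :=
  {C : Finset (Fin n →₀ ℕ) | IsMaximalCluster G d j C}.ncard

open Classical in
/-- The depth of an `R`-module `M` with respect to an ideal `J`: the supremum of the lengths of the
`M`-regular sequences of elements of `J` (and `∞` when `J M = M`). -/
noncomputable def moduleDepth {R : Type*} [CommRing R] (J : Ideal R) (M : Type*) [AddCommGroup M]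
    [Module R M] : ℕ∞ :=
  if J • (⊤ : Submodule R M) = ⊤ then ⊤
  else ⨆ rs : {rs : List R // (∀ r ∈ rs, r ∈ J) ∧ RingTheory.Sequence.IsRegular M rs},
    (rs.1.length : ℕ∞)

/-- The irrelevant ideal of a polynomial ring: the ideal generated by all the variables. -/
noncomputable def irrelevantIdeal (σ : Type*) (K : Type*) [Field K] : Ideal (MvPolynomial σ K) :=
  Ideal.span (Set.range X)

/-! ### Regular sequences, Ext vanishing and associated primes -/

section Algebra

open RingTheory.Sequence Abelian Pointwise

variable {R : Type u} [CommRing R]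

/-! Let `L` be the `*`-linearization. The number `N` is the largest number of generators `f_j`
divisible by one edge, and both equalities come from squeezing `R/L` between linear quotients and
one associated prime.

Upper bound for pd: `L` has linear quotients. Add the squarefree monomials of degree `d` in
lexicographic order, then the monomials `u y_j` by increasing `j`. The colon ideal at `u y_j` is
generated by the `n-d+1` variables `x_i` not dividing `u` and by the `y_i` with `i < j` and `u ∣
f_i`, of which there are at most `N-1`. Each step is an exact sequence `0 → R/(L' : g) → R/L' →
R/(L' + (g)) → 0`, so pd `R/L ≤ n-d+N+1`.

Lower bound for pd: if the edge `u` divides `N` generators, then `L : u` is generated by the `n-d+1`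
variables `x_i ∤ u` and the `N` variables `y_j` with `u ∣ f_j`. It is an associated prime `P` of
`R/L`, so `Hom(R/P, R/L) ≠ 0`, whereas a smaller pd would make this Hom vanish.

Depth: a regular sequence is no longer than `dim R/P`, and the pd bound makes `Ext^i(R/𝔪, R/L)`
vanish in the degrees needed to produce a sequence of that length. -/

lemma hasProjectiveDimensionLT_quotient_of_isWeaklyRegular (rs : List R) (k : ℕ)
    (M : Type u) [AddCommGroup M] [Module R M]
    (hM : HasProjectiveDimensionLT (ModuleCat.of R M) (k + 1)) (reg : IsWeaklyRegular M rs) :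
    HasProjectiveDimensionLT
      (ModuleCat.of R (M ⧸ (Ideal.ofList rs • ⊤ : Submodule R M))) (k + rs.length + 1) := by
  induction rs generalizing M k with
  | nil =>
    have e : M ≃ₗ[R] (M ⧸ (Ideal.ofList ([] : List R) • ⊤ : Submodule R M)) :=
      (Submodule.quotEquivOfEqBot _ (by simp)).symm
    exact hasProjectiveDimensionLT_of_iso e.toModuleIso _
  | cons x rs ih =>
    rw [isWeaklyRegular_cons_iff] at reg
    -- Multiplication by `x` gives `0 → M → M → M/xM → 0`, which raises the bound by at most one.
    have h : HasProjectiveDimensionLT (ModuleCat.of R (QuotSMulTop x M)) (k + 1 + 1) :=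
      (IsSMulRegular.smulShortComplex_shortExact (M := ModuleCat.of R M)
        reg.1).hasProjectiveDimensionLT_X₃ (k + 1) hM
        (hasProjectiveDimensionLT_of_ge (ModuleCat.of R M) (k + 1) (k + 2) (by omega))
    have h' := ih (k + 1) _ h reg.2
    have e := (Submodule.quotOfListConsSMulTopEquivQuotSMulTopInner M x rs).symm
    have := hasProjectiveDimensionLT_of_iso e.toModuleIso (k + 1 + rs.length + 1)
    convert this using 1
    simp; omega

lemma hasProjectiveDimensionLT_quotient_ofList (rs : List R) (reg : IsWeaklyRegular R rs) :
    HasProjectiveDimensionLT (ModuleCat.of R (R ⧸ Ideal.ofList rs)) (rs.length + 1) := by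
  have h := hasProjectiveDimensionLT_quotient_of_isWeaklyRegular rs 0 R inferInstance reg
  have e : (R ⧸ (Ideal.ofList rs • ⊤ : Submodule R R)) ≃ₗ[R] (R ⧸ Ideal.ofList rs) :=
    Submodule.quotEquivOfEq _ _ (by simp)
  have := hasProjectiveDimensionLT_of_iso e.toModuleIso (0 + rs.length + 1)
  simpa using this

variable [IsNoetherianRing R]

/-- By flatness the sequence stays regular on a nonzero free module, and Rees' theorem kills Ext
below its length. -/
lemma subsingleton_ext_quotient_of_free (rs : List R) (reg : IsWeaklyRegular R rs)
    (hrs : Ideal.ofList rs ≠ ⊤) (F : ModuleCat.{u} R) [Module.Free R F] [Module.Finite R F]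
    (j : ℕ) (hj : j < rs.length) :
    Subsingleton (Ext (ModuleCat.of R (R ⧸ Ideal.ofList rs)) F j) := by
  rcases subsingleton_or_nontrivial F with h | h
  · have hz : Limits.IsZero F := ModuleCat.isZero_of_subsingleton F
    refine subsingleton_of_forall_eq 0 fun e ↦ ?_
    rw [← Ext.comp_mk₀_id e, hz.eq_of_src (𝟙 F) 0, Ext.mk₀_zero, Ext.comp_zero]
  · have hF : IsWeaklyRegular F rs :=
      ((TensorProduct.rid R F).isWeaklyRegular_congr rs).mp reg.isWeaklyRegular_lTensor
    have hne : Ideal.ofList rs • (⊤ : Submodule R F) ≠ ⊤ :=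
      ((Module.FaithfullyFlat.iff_flat_and_proper_ideal R F).mp inferInstance).2 _ hrs
    refine ModuleCat.subsingleton_ext_of_exists_isRegular (Ideal.ofList rs) _ ?_ F hne.lt_top rs
      (fun r hr ↦ Ideal.subset_span hr) ⟨hF, hne.symm⟩ j hj
    change Module.support R (R ⧸ Ideal.ofList rs) ⊆ _
    rw [Module.support_eq_zeroLocus, Ideal.annihilator_quotient]

/-- Dimension shifting along `0 → K → F → M → 0` with `F` free: each syzygy trades one unit of pd
for one degree of Ext. This bounds pd from below (with `j = 0`) and depth from below. -/
lemma subsingleton_ext_quotient_of_hasProjectiveDimensionLT (rs : List R)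
    (reg : IsWeaklyRegular R rs) (hrs : Ideal.ofList rs ≠ ⊤) (p : ℕ) (M : ModuleCat.{u} R)
    [Module.Finite R M] (hM : HasProjectiveDimensionLT M (p + 1)) (j : ℕ)
    (hj : j + p < rs.length) :
    Subsingleton (Ext (ModuleCat.of R (R ⧸ Ideal.ofList rs)) M j) := by
  induction p generalizing M j with
  | zero =>
    obtain ⟨F, _, _, _, _, g, hg⟩ := Module.exists_finite_presentation R M
    have := subsingleton_ext_quotient_of_free rs reg hrs (ModuleCat.of R F) j (by omega)
    have hproj : Projective M := projective_iff_hasProjectiveDimensionLT_one.mpr hM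
    have : Epi (ModuleCat.ofHom g) := (ModuleCat.epi_iff_surjective _).mpr hg
    have hs := Projective.factorThru_comp (𝟙 M) (ModuleCat.ofHom g : ModuleCat.of R F ⟶ M)
    refine subsingleton_of_forall_eq 0 fun e ↦ ?_
    rw [← Ext.comp_mk₀_id e, ← hs, ← Ext.mk₀_comp_mk₀, ← Ext.comp_assoc_of_second_deg_zero,
      Subsingleton.elim (e.comp (Ext.mk₀ _) _) 0, Ext.zero_comp]
  | succ p ih =>
    obtain ⟨F, _, _, _, _, g, hg⟩ := Module.exists_finite_presentation R M
    have h1 := subsingleton_ext_quotient_of_free rs reg hrs (ModuleCat.of R F) j (by omega)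
    let S : ShortComplex (ModuleCat.{u} R) :=
      LinearMap.shortComplexKer (M := F) (N := M) g
    have hS : S.ShortExact := LinearMap.shortExact_shortComplexKer hg
    have hK := (hS.hasProjectiveDimensionLT_X₃_iff p
      (inferInstanceAs (Projective (ModuleCat.of R F)))).mp hM
    have h2 := ih S.X₁ hK (j + 1) (by omega)
    have zero1 := AddCommGrpCat.isZero_of_iff_subsingleton.mpr h1
    have zero2 := AddCommGrpCat.isZero_of_iff_subsingleton.mpr h2
    exact AddCommGrpCat.subsingleton_of_isZero <| ShortComplex.Exact.isZero_of_both_zeros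
        ((Ext.covariant_sequence_exact₃' _ hS) j (j + 1) rfl)
        (zero1.eq_zero_of_src _) (zero2.eq_zero_of_tgt _)

/-- Let `N` be the submodule killed by `Q`. Since `x` is regular on `M`, `N/xN` embeds in `M/xM`; it
is nonzero at `𝔪`, and all its associated primes contain `Q` and `x ∉ Q`. -/
lemma exists_associatedPrimes_quotSMulTop_lt (M : Type u) [AddCommGroup M] [Module R M]
    [Module.Finite R M] {Q 𝔪 : Ideal R} [𝔪.IsPrime] (hQ : Q ∈ associatedPrimes R M)
    (hQm : Q ≤ 𝔪) {x : R} (hx : x ∈ 𝔪) (reg : IsSMulRegular M x) :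
    ∃ Q' ∈ associatedPrimes R (QuotSMulTop x M), Q < Q' ∧ Q' ≤ 𝔪 := by
  obtain ⟨hQp, a, ha⟩ := isAssociatedPrime_iff.mp hQ
  have ha' : ∀ r, r ∈ Q ↔ r • a = 0 := fun r ↦ by rw [ha]; simp
  let N : Submodule R M :=
    { carrier := {m | ∀ r ∈ Q, r • m = 0}
      add_mem' := fun h1 h2 r hr ↦ by rw [smul_add, h1 r hr, h2 r hr, add_zero]
      zero_mem' := fun r _ ↦ smul_zero r
      smul_mem' := fun c m h r hr ↦ by rw [smul_comm, h r hr, smul_zero] }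
  have haN : a ∈ N := fun r hr ↦ (ha' r).mp hr
  have hxQ : x ∉ Q := fun h ↦ hQp.ne_top <| (Ideal.eq_top_iff_one _).mpr <| (ha' 1).mpr <| by
    rw [one_smul]; exact reg (by simpa using (ha' x).mp h)
  have hsupp : (⟨𝔪, inferInstance⟩ : PrimeSpectrum R) ∈ Module.support R (QuotSMulTop x N) := by
    rw [Module.support_quotSMulTop]
    refine ⟨Module.mem_support_iff_exists_annihilator.mpr ⟨⟨a, haN⟩, fun r hr ↦ hQm ?_⟩, ?_⟩
    · rw [Submodule.mem_annihilator_span_singleton] at hr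
      exact (ha' r).mpr (congrArg Subtype.val hr)
    · simpa using hx
  obtain ⟨b, hb⟩ := Module.mem_support_iff_exists_annihilator.mp hsupp
  obtain ⟨Q', hQ', hQ'm⟩ := Ideal.exists_minimalPrimes_le hb
  have hQ'a : Q' ∈ associatedPrimes R (Submodule.span R {b}) := by
    apply Module.associatedPrimes.minimalPrimes_annihilator_subset_associatedPrimes
    exact hQ'
  have hQ'b := associatedPrimes.subset_of_injective
    (Submodule.span R {b}).injective_subtype hQ'a
  have hinj : Function.Injective (QuotSMulTop.map x N.subtype) := by
    rw [← LinearMap.ker_eq_bot, LinearMap.ker_eq_bot']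
    intro m hm
    obtain ⟨c, rfl⟩ := Submodule.Quotient.mk_surjective _ m
    have hm' : (Submodule.Quotient.mk (c : M) : QuotSMulTop x M) = 0 := hm
    rw [Submodule.Quotient.mk_eq_zero, Submodule.mem_smul_pointwise_iff_exists] at hm'
    obtain ⟨m', -, hm'⟩ := hm'
    rw [Submodule.Quotient.mk_eq_zero, Submodule.mem_smul_pointwise_iff_exists]
    -- If `x m'` is killed by `Q`, then so is `m'`, as `x` is regular.
    refine ⟨⟨m', fun r hr ↦ reg ?_⟩, trivial, Subtype.ext hm'⟩
    change x • r • m' = x • 0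
    rw [smul_comm, hm', c.2 r hr, smul_zero]
  have hann : ∀ r, (r ∈ Q ∨ r = x) → r ∈ Q' := fun r hr ↦ by
    refine hQ'.1.2 ?_
    rw [Submodule.mem_annihilator_span_singleton]
    obtain ⟨c, rfl⟩ := Submodule.Quotient.mk_surjective _ b
    rw [← Submodule.Quotient.mk_smul, Submodule.Quotient.mk_eq_zero]
    rcases hr with hr | rfl
    · have : r • c = 0 := Subtype.ext (c.2 r hr)
      rw [this]; exact zero_mem _
    · exact Submodule.smul_mem_pointwise_smul _ _ _ trivial
  refine ⟨Q', associatedPrimes.subset_of_injective hinj hQ'b, ?_, hQ'm⟩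
  refine lt_of_le_of_ne (fun r hr ↦ hann r (.inl hr)) ?_
  rintro rfl
  exact hxQ (hann x (.inr rfl))

lemma exists_ltSeries_of_isWeaklyRegular (rs : List R) (M : Type u) [AddCommGroup M] [Module R M]
    [Module.Finite R M] (𝔪 : Ideal R) [𝔪.IsPrime] (Q : PrimeSpectrum R)
    (hQ : Q.asIdeal ∈ associatedPrimes R M) (hQm : Q.asIdeal ≤ 𝔪) (hrs : ∀ r ∈ rs, r ∈ 𝔪)
    (reg : IsWeaklyRegular M rs) :
    ∃ p : LTSeries (PrimeSpectrum R), p.head = Q ∧ p.length = rs.length := by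
  induction rs generalizing M Q with
  | nil => exact ⟨RelSeries.singleton _ Q, rfl, rfl⟩
  | cons x rs ih =>
    rw [isWeaklyRegular_cons_iff] at reg
    obtain ⟨Q', hQ', hlt, hle⟩ :=
      exists_associatedPrimes_quotSMulTop_lt M hQ hQm (hrs x (by simp)) reg.1
    obtain ⟨p, hp, hl⟩ := ih (QuotSMulTop x M) ⟨Q', hQ'.isPrime⟩ hQ' hle
      (fun r hr ↦ hrs r (by simp [hr])) reg.2
    exact ⟨p.cons Q (by rw [hp]; exact hlt), by simp, by simp [hl]⟩

/-- Each element of the sequence forces a strictly larger prime, so the sequence yields a chain of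
primes starting at `Q`. -/
lemma length_le_ringKrullDim_quotient (rs : List R) (M : Type u) [AddCommGroup M] [Module R M]
    [Module.Finite R M] (𝔪 : Ideal R) [𝔪.IsPrime] (Q : Ideal R)
    (hQ : Q ∈ associatedPrimes R M) (hQm : Q ≤ 𝔪) (hrs : ∀ r ∈ rs, r ∈ 𝔪)
    (reg : IsWeaklyRegular M rs) : (rs.length : WithBot ℕ∞) ≤ ringKrullDim (R ⧸ Q) := by
  obtain ⟨p, hp, hl⟩ := exists_ltSeries_of_isWeaklyRegular rs M 𝔪 ⟨Q, hQ.isPrime⟩ hQ hQm hrs reg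
  rw [ringKrullDim_quotient, ← hl]
  let q : LTSeries (PrimeSpectrum.zeroLocus (R := R) Q) :=
    { length := p.length
      toFun := fun i ↦ ⟨p i, by
        have h : p.head ≤ p i := LTSeries.head_le _ i
        rw [hp] at h
        exact h⟩
      step := fun i ↦ p.step i }
  exact Order.LTSeries.length_le_krullDim q

end Algebra

universe v

/-! ### Monomial ideals and ideals generated by variables -/

section Monomial

open RingTheory.Sequence

variable {σ : Type v} {K : Type u} [Field K]

/-- The monomial ideal generated by the monomials with exponent vectors in `S`. -/
noncomputable def monomialSpan {σ : Type*} (K : Type*) [Field K] (S : Set (σ →₀ ℕ)) :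
    Ideal (MvPolynomial σ K) :=
  Ideal.span ((fun s ↦ monomial s (1 : K)) '' S)

lemma mul_monomial_mem_monomialSpan_iff {σ : Type*} {K : Type*} [Field K] {S : Set (σ →₀ ℕ)}
    {a : σ →₀ ℕ} {p : MvPolynomial σ K} :
    p * monomial a 1 ∈ monomialSpan K S ↔ ∀ b ∈ p.support, ∃ s ∈ S, s ≤ b + a := by
  rw [monomialSpan, mem_ideal_span_monomial_image]
  constructor
  · intro h b hb
    refine h (b + a) ?_
    rw [mem_support_iff] at hb ⊢
    rwa [coeff_mul_monomial, mul_one]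
  · intro h c hc
    rw [mem_support_iff, coeff_mul_monomial'] at hc
    split_ifs at hc with hac
    · obtain ⟨s, hs, hle⟩ := h (c - a) (by rw [mem_support_iff]; simpa using hc)
      exact ⟨s, hs, by rwa [tsub_add_cancel_of_le hac] at hle⟩
    · exact absurd rfl hc

/-- A combinatorial test for a colon ideal to be generated by variables: `h₁` puts the variables of
`V` in it, and `h₂` says that no generator divides a multiple of `x^a` by a monomial free of `V`. -/
lemma mul_monomial_mem_monomialSpan_iff_mem_span_X {σ : Type*} {K : Type*} [Field K]
    {S : Set (σ →₀ ℕ)} {a : σ →₀ ℕ} {V : Set σ}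
    (h₁ : ∀ v ∈ V, ∃ s ∈ S, s ≤ Finsupp.single v 1 + a) (h₂ : ∀ s ∈ S, ∃ v ∈ V, a v < s v)
    {p : MvPolynomial σ K} :
    p * monomial a 1 ∈ monomialSpan K S ↔ p ∈ Ideal.span (X '' V : Set (MvPolynomial σ K)) := by
  rw [mul_monomial_mem_monomialSpan_iff, mem_ideal_span_X_image]
  refine forall₂_congr fun b _ ↦ ⟨fun ⟨s, hs, hle⟩ ↦ ?_, fun ⟨v, hv, hb⟩ ↦ ?_⟩
  · obtain ⟨v, hv, hlt⟩ := h₂ s hs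
    have := hle v
    rw [Finsupp.add_apply] at this
    exact ⟨v, hv, by omega⟩
  · obtain ⟨s, hs, hle⟩ := h₁ v hv
    refine ⟨s, hs, hle.trans (add_le_add_left ?_ a)⟩
    rw [Finsupp.single_le_iff]
    omega

lemma X_mul_mem_span_X_image_iff {σ : Type*} {K : Type*} [Field K] {V : Set σ} {i : σ}
    (hi : i ∉ V) {p : MvPolynomial σ K} (h : X i * p ∈ Ideal.span (X '' V)) :
    p ∈ Ideal.span (X '' V : Set (MvPolynomial σ K)) := by
  rw [mem_ideal_span_X_image] at h ⊢
  intro b hb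
  obtain ⟨v, hv, hne⟩ := h (Finsupp.single i 1 + b) (by
    rw [mem_support_iff] at hb ⊢
    rwa [coeff_X_mul])
  refine ⟨v, hv, fun h0 ↦ hne ?_⟩
  rw [Finsupp.add_apply, h0, Finsupp.single_eq_of_ne (fun h : v = i ↦ hi (h ▸ hv))]

lemma ofList_map_X {σ : Type*} (K : Type*) [Field K] (l : List σ) :
    Ideal.ofList (l.map (X : σ → MvPolynomial σ K)) = Ideal.span (X '' {i | i ∈ l}) := by
  rw [Ideal.ofList]
  congr 1
  ext p
  simp

lemma isWeaklyRegular_map_X {σ : Type*} (K : Type*) [Field K] (l : List σ) (hl : l.Nodup) :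
    IsWeaklyRegular (MvPolynomial σ K) (l.map (X : σ → MvPolynomial σ K)) := by
  refine ⟨fun i hi ↦ ?_⟩
  rw [List.length_map] at hi
  rw [← List.map_take, ofList_map_X, List.getElem_map, isSMulRegular_iff_right_eq_zero_of_smul]
  intro p hp
  obtain ⟨p, rfl⟩ := Submodule.Quotient.mk_surjective _ p
  rw [← Submodule.Quotient.mk_smul, Submodule.Quotient.mk_eq_zero, smul_eq_mul, smul_eq_mul,
    Ideal.mul_top] at hp
  rw [Submodule.Quotient.mk_eq_zero, smul_eq_mul, Ideal.mul_top]
  refine X_mul_mem_span_X_image_iff ?_ hp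
  intro hmem
  obtain ⟨k, hk, hk'⟩ := List.mem_take_iff_getElem.mp hmem
  have := (List.Nodup.getElem_inj_iff hl).mp hk'
  omega

lemma span_X_image_ne_top {σ : Type*} (K : Type*) [Field K] (V : Set σ) :
    Ideal.span (X '' V : Set (MvPolynomial σ K)) ≠ ⊤ := by
  rw [Ideal.ne_top_iff_one, mem_ideal_span_X_image]
  intro h
  obtain ⟨i, -, hi⟩ := h 0 (by simp)
  exact hi rfl

/-- The ideal is the kernel of the substitution sending the variables of `V` to zero, an
endomorphism of a domain. -/
lemma isPrime_span_X_image {σ : Type*} (K : Type*) [Field K] (V : Set σ) :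
    (Ideal.span (X '' V : Set (MvPolynomial σ K))).IsPrime := by
  classical
  let φ : MvPolynomial σ K →ₐ[K] MvPolynomial σ K := aeval fun i ↦ if i ∈ V then 0 else X i
  have hφ (p : MvPolynomial σ K) : p - φ p ∈ Ideal.span (X '' V : Set (MvPolynomial σ K)) := by
    rw [← Ideal.Quotient.eq]
    have : (Ideal.Quotient.mkₐ K (Ideal.span (X '' V))) =
        (Ideal.Quotient.mkₐ K (Ideal.span (X '' V : Set (MvPolynomial σ K)))).comp φ := by
      refine algHom_ext fun i ↦ ?_
      rw [AlgHom.comp_apply, aeval_X]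
      split_ifs with h
      · rw [map_zero]
        exact Ideal.Quotient.eq_zero_iff_mem.mpr (Ideal.subset_span ⟨i, h, rfl⟩)
      · rfl
    exact DFunLike.congr_fun this p
  have : Ideal.span (X '' V : Set (MvPolynomial σ K)) = RingHom.ker φ := by
    refine le_antisymm (Ideal.span_le.mpr ?_) fun p hp ↦ ?_
    · rintro _ ⟨i, hi, rfl⟩
      simp [φ, hi]
    · simpa [(RingHom.mem_ker).mp hp] using hφ p
  rw [this]
  exact RingHom.ker_isPrime _

lemma ringKrullDim_quotient_span_X_image_le {σ : Type*} [Finite σ] (K : Type*) [Field K]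
    (V : Set σ) :
    ringKrullDim (MvPolynomial σ K ⧸ Ideal.span (X '' V : Set (MvPolynomial σ K))) ≤
      (Nat.card (Vᶜ : Set σ) : WithBot ℕ∞) := by
  let I := Ideal.span (X '' V : Set (MvPolynomial σ K))
  let φ : MvPolynomial (Vᶜ : Set σ) K →ₐ[K] MvPolynomial σ K ⧸ I :=
    aeval fun i ↦ Ideal.Quotient.mkₐ K I (X i.1)
  have hφ : Function.Surjective φ := by
    rw [← AlgHom.range_eq_top, eq_top_iff]
    rintro q -
    obtain ⟨p, rfl⟩ := Ideal.Quotient.mkₐ_surjective K I q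
    induction p using MvPolynomial.induction_on with
    | C a => exact φ.range.algebraMap_mem a
    | add p q hp hq => rw [map_add]; exact add_mem hp hq
    | mul_X p i hp =>
      rw [map_mul]
      refine mul_mem hp ?_
      by_cases hi : i ∈ V
      · have : Ideal.Quotient.mkₐ K I (X i) = 0 :=
          Ideal.Quotient.eq_zero_iff_mem.mpr (Ideal.subset_span ⟨i, hi, rfl⟩)
        rw [this]
        exact zero_mem _
      · exact ⟨X ⟨i, hi⟩, by simp [φ]⟩
  refine (ringKrullDim_le_of_surjective φ.toRingHom hφ).trans ?_
  rw [MvPolynomial.ringKrullDim_of_isNoetherianRing, ringKrullDim_eq_zero_of_field, zero_add]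

lemma hasProjectiveDimensionLT_quotient_span_X (V : Finset σ) :
    HasProjectiveDimensionLT (ModuleCat.of (MvPolynomial σ K)
      (MvPolynomial σ K ⧸ Ideal.span (X '' (V : Set σ) : Set (MvPolynomial σ K))))
      (V.card + 1) := by
  have h := hasProjectiveDimensionLT_quotient_ofList _
    (isWeaklyRegular_map_X K V.toList V.nodup_toList)
  have hV : {i | i ∈ V.toList} = (V : Set σ) := by ext; simp
  rw [ofList_map_X, hV] at h
  simpa using h

end Monomial

/-! ### Projective dimension from linear quotients -/

section LinearQuotients

/-- If `I : g = J` and `pd (R/J) ≤ p`, `pd (R/I) ≤ p + 1`, then `pd (R/(I + (g))) ≤ p + 1`. -/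
lemma hasProjectiveDimensionLT_quotient_sup_span_singleton {R : Type u} [CommRing R]
    (I J : Ideal R) (g : R) (p : ℕ) (hJ : ∀ r, r * g ∈ I ↔ r ∈ J)
    (h₁ : HasProjectiveDimensionLT (ModuleCat.of R (R ⧸ J)) (p + 1))
    (h₂ : HasProjectiveDimensionLT (ModuleCat.of R (R ⧸ I)) (p + 2)) :
    HasProjectiveDimensionLT (ModuleCat.of R (R ⧸ (I ⊔ Ideal.span {g}))) (p + 2) := by
  let φ : (R ⧸ J) →ₗ[R] (R ⧸ I) :=
    Submodule.mapQ J I (LinearMap.toSpanSingleton R R g) fun r hr ↦ by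
      simpa using (hJ r).mpr hr
  let ψ : (R ⧸ I) →ₗ[R] (R ⧸ (I ⊔ Ideal.span {g})) :=
    Submodule.factor le_sup_left
  have hφ : Function.Injective φ := by
    rw [← LinearMap.ker_eq_bot, LinearMap.ker_eq_bot']
    intro r hr
    obtain ⟨r, rfl⟩ := Submodule.Quotient.mk_surjective _ r
    have hr' : (Submodule.Quotient.mk (r * g) : R ⧸ I) = 0 := hr
    rw [Submodule.Quotient.mk_eq_zero] at hr' ⊢
    exact (hJ r).mp hr'
  have hψ : Function.Surjective ψ := Submodule.factor_surjective _
  have hex : Function.Exact φ ψ := by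
    intro r
    obtain ⟨r, rfl⟩ := Submodule.Quotient.mk_surjective _ r
    change (Submodule.Quotient.mk r : R ⧸ (I ⊔ Ideal.span {g})) = 0 ↔ _
    rw [Submodule.Quotient.mk_eq_zero]
    constructor
    · intro h
      obtain ⟨a, ha, b, hb, rfl⟩ := Submodule.mem_sup.mp h
      obtain ⟨c, rfl⟩ := Ideal.mem_span_singleton'.mp hb
      refine ⟨Submodule.Quotient.mk c, ?_⟩
      change Submodule.Quotient.mk (c * g) = _
      rw [Submodule.Quotient.eq]
      simpa using ha
    · rintro ⟨c, hc⟩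
      obtain ⟨c, rfl⟩ := Submodule.Quotient.mk_surjective _ c
      have hc' : (Submodule.Quotient.mk (c * g) : R ⧸ I) = Submodule.Quotient.mk r := hc
      rw [eq_comm, Submodule.Quotient.eq] at hc'
      exact Submodule.mem_sup.mpr ⟨_, hc', c * g, Ideal.mem_span_singleton'.mpr ⟨c, rfl⟩, by ring⟩
  let S : ShortComplex (ModuleCat.{u} R) :=
    ModuleCat.shortComplexOfCompEqZero φ ψ hex.linearMap_comp_eq_zero
  have hS : S.ShortExact :=
    { exact := ModuleCat.shortComplex_exact _ hex
      mono_f := (ModuleCat.mono_iff_injective _).mpr hφ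
      epi_g := (ModuleCat.epi_iff_surjective _).mpr hψ }
  exact hS.hasProjectiveDimensionLT_X₃ (p + 1) h₁ h₂

/-- A criterion for linear quotients: the generators in `e '' G` are added in the order of `key`
to the monomial ideal generated by `S₀`, and each colon ideal that occurs is generated by a set `V`
of at most `p` variables. -/
lemma hasProjectiveDimensionLT_quotient_monomialSpan_of_linearQuotients
    {σ : Type v} {K : Type u} [Field K] {ι α : Type*} [LinearOrder α] (S₀ : Set (σ →₀ ℕ)) (p : ℕ)
    (h₀ : HasProjectiveDimensionLT
      (ModuleCat.of (MvPolynomial σ K) (MvPolynomial σ K ⧸ monomialSpan K S₀)) (p + 2))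
    (G : Finset ι) (e : ι → σ →₀ ℕ) (key : ι → α)
    (H : ∀ a ∈ G, ∃ V : Finset σ, V.card ≤ p ∧
      (∀ v ∈ V, (∃ s ∈ S₀, s ≤ Finsupp.single v 1 + e a) ∨
        ∃ b ∈ G, key b < key a ∧ e b ≤ Finsupp.single v 1 + e a) ∧
      (∀ s ∈ S₀, ∃ v ∈ V, e a v < s v) ∧
      ∀ b ∈ G, key b ≤ key a → b ≠ a → ∃ v ∈ V, e a v < e b v) :
    HasProjectiveDimensionLT (ModuleCat.of (MvPolynomial σ K)
      (MvPolynomial σ K ⧸ monomialSpan K (S₀ ∪ e '' (G : Set ι)))) (p + 2) := by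
  classical
  -- Induct on initial segments of `key`. Ties may be added in any order, so the colon variables
  -- come only from strictly smaller keys, while every generator of equal key must be separated by
  -- `V`.
  suffices ∀ s : Finset ι, s ⊆ G → (∀ a ∈ s, ∀ b ∈ G, key b < key a → b ∈ s) →
      HasProjectiveDimensionLT (ModuleCat.of (MvPolynomial σ K)
        (MvPolynomial σ K ⧸ monomialSpan K (S₀ ∪ e '' (s : Set ι)))) (p + 2) from
    this G subset_rfl fun _ _ b hb _ ↦ hb
  intro s
  induction s using Finset.induction_on_max_value key with
  | empty =>
    intro _ _
    rw [Finset.coe_empty, Set.image_empty, Set.union_empty]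
    exact h₀
  | insert a s has hmax ih =>
    intro hsG hclosed
    have haG := hsG (Finset.mem_insert_self a s)
    have hI := ih ((Finset.subset_insert a s).trans hsG) fun c hc b hb hbc ↦ by
      rcases Finset.mem_insert.mp (hclosed c (Finset.mem_insert_of_mem hc) b hb hbc) with rfl | h
      · exact absurd (hmax c hc) hbc.not_ge
      · exact h
    obtain ⟨V, hVp, hV₁, hV₂, hV₃⟩ := H a haG
    have hcolon : ∀ r : MvPolynomial σ K,
        r * monomial (e a) 1 ∈ monomialSpan K (S₀ ∪ e '' (s : Set ι)) ↔
          r ∈ Ideal.span (X '' (V : Set σ)) := fun r ↦ by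
      refine mul_monomial_mem_monomialSpan_iff_mem_span_X (fun v hv ↦ ?_) ?_
      · rcases hV₁ v hv with ⟨t, ht, hle⟩ | ⟨b, hb, hlt, hle⟩
        · exact ⟨t, .inl ht, hle⟩
        · refine ⟨e b, .inr ⟨b, ?_, rfl⟩, hle⟩
          rcases Finset.mem_insert.mp (hclosed a (Finset.mem_insert_self a s) b hb hlt) with rfl | h
          · exact absurd hlt (lt_irrefl _)
          · exact h
      · rintro t (ht | ⟨b, hb, rfl⟩)
        · exact hV₂ t ht
        · exact hV₃ b (hsG (Finset.mem_insert_of_mem hb)) (hmax b hb) fun h ↦ has (h ▸ hb)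
    have hJ : HasProjectiveDimensionLT (ModuleCat.of (MvPolynomial σ K)
        (MvPolynomial σ K ⧸ Ideal.span (X '' (V : Set σ) : Set (MvPolynomial σ K)))) (p + 1) :=
      have := hasProjectiveDimensionLT_quotient_span_X (K := K) V
      hasProjectiveDimensionLT_of_ge _ (V.card + 1) _ (by omega)
    have := hasProjectiveDimensionLT_quotient_sup_span_singleton _ _ _ p hcolon hJ hI
    have heq : monomialSpan K (S₀ ∪ e '' (s : Set ι)) ⊔ Ideal.span {monomial (e a) 1} =
        monomialSpan K (S₀ ∪ e '' ((insert a s : Finset ι) : Set ι)) := by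
      rw [monomialSpan, monomialSpan, ← Ideal.span_union, ← Set.image_singleton (f := fun s ↦
        (monomial s (1 : K))), ← Set.image_union, Finset.coe_insert, Set.image_insert_eq,
        Set.union_assoc, Set.insert_eq, Set.union_comm {e a}]
    rwa [heq] at this

end LinearQuotients

/-! ### Exact pd and depth from an associated prime generated by variables -/

section AssociatedVariablePrime

open RingTheory.Sequence Abelian

/-- The embedding of `R/P` into `M` is a nonzero element of `Ext^0(R/P, M)`, which would vanish if
pd were below the length of the regular sequence `V`. -/
lemma not_hasProjectiveDimensionLT_of_mem_associatedPrimes {σ : Type v} [Finite σ] {K : Type u}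
    [Field K] (M : Type (max u v)) [AddCommGroup M] [Module (MvPolynomial σ K) M]
    [Module.Finite (MvPolynomial σ K) M] (V : Finset σ)
    (hV : Ideal.span (X '' (V : Set σ) : Set (MvPolynomial σ K)) ∈
      associatedPrimes (MvPolynomial σ K) M) :
    ¬ HasProjectiveDimensionLT (ModuleCat.of (MvPolynomial σ K) M) V.card := by
  intro h
  obtain ⟨φ, hφ⟩ := (isAssociatedPrime_iff_exists_injective_linearMap _ _).mp hV |>.2
  have hne := span_X_image_ne_top K (V : Set σ)
  have hset : {i | i ∈ V.toList} = (V : Set σ) := by ext; simp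
  have hVl : Ideal.ofList (V.toList.map (X : σ → MvPolynomial σ K)) =
      Ideal.span (X '' (V : Set σ)) := by rw [ofList_map_X, hset]
  have hnt : Nontrivial (MvPolynomial σ K ⧸ Ideal.span (X '' (V : Set σ) :
      Set (MvPolynomial σ K))) := Ideal.Quotient.nontrivial_iff.mpr hne
  have hM : Nontrivial M := hφ.nontrivial
  rcases hc : V.card with _ | k
  · rw [hc] at h
    have := ModuleCat.subsingleton_of_isZero (isZero_of_hasProjectiveDimensionLT_zero
      (ModuleCat.of (MvPolynomial σ K) M))
    exact not_subsingleton M this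
  · rw [hc] at h
    have hsub := subsingleton_ext_quotient_of_hasProjectiveDimensionLT _
      (isWeaklyRegular_map_X K V.toList V.nodup_toList) (hVl ▸ hne) k
      (ModuleCat.of (MvPolynomial σ K) M) h 0 (by simp [hc])
    rw [hVl] at hsub
    have hlin := (Ext.addEquiv₀.trans ModuleCat.homAddEquiv).symm.subsingleton_congr.mpr hsub
    have h0 : φ = 0 := hlin.elim φ 0
    obtain ⟨x, hx⟩ := exists_ne (0 : MvPolynomial σ K ⧸ Ideal.span (X '' (V : Set σ) :
      Set (MvPolynomial σ K)))
    exact hx (hφ (by rw [h0]; rfl))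

lemma irrelevantIdeal_eq_span_X_image (σ : Type*) (K : Type*) [Field K] :
    irrelevantIdeal σ K = Ideal.span (X '' Set.univ) := by
  rw [irrelevantIdeal, Set.image_univ]

/-- If `pd M ≤ s` and `M` has an associated prime generated by `s` of the variables, then the depth
of `M` with respect to the irrelevant ideal is the number of variables minus `s`. -/
theorem moduleDepth_irrelevantIdeal_of_mem_associatedPrimes {σ : Type v} [Fintype σ] {K : Type u}
    [Field K] (M : Type (max u v)) [AddCommGroup M] [Module (MvPolynomial σ K) M]
    [Module.Finite (MvPolynomial σ K) M] (V : Finset σ)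
    (hV : Ideal.span (X '' (V : Set σ) : Set (MvPolynomial σ K)) ∈
      associatedPrimes (MvPolynomial σ K) M)
    (hM : HasProjectiveDimensionLT (ModuleCat.of (MvPolynomial σ K) M) (V.card + 1)) :
    moduleDepth (irrelevantIdeal σ K) M = ((Fintype.card σ - V.card : ℕ) : ℕ∞) := by
  have h𝔪 := irrelevantIdeal_eq_span_X_image σ K
  have hprime : (irrelevantIdeal σ K).IsPrime := h𝔪 ▸ isPrime_span_X_image K Set.univ
  have hle : Ideal.span (X '' (V : Set σ) : Set (MvPolynomial σ K)) ≤ irrelevantIdeal σ K :=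
    h𝔪 ▸ Ideal.span_mono (Set.image_mono (Set.subset_univ _))
  have hne : irrelevantIdeal σ K • (⊤ : Submodule (MvPolynomial σ K) M) ≠ ⊤ := by
    intro h
    -- Nakayama: some `r ≡ 1` modulo `𝔪` kills `M`, hence lies in the associated prime, which is
    -- inside `𝔪`.
    obtain ⟨r, hr, hr'⟩ := Submodule.exists_sub_one_mem_and_smul_eq_zero_of_fg_of_le_smul
      (irrelevantIdeal σ K) (⊤ : Submodule (MvPolynomial σ K) M) Module.Finite.fg_top h.ge
    obtain ⟨-, a, ha⟩ := isAssociatedPrime_iff.mp hV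
    have hrV : r ∈ Ideal.span (X '' (V : Set σ) : Set (MvPolynomial σ K)) := by
      rw [ha]; simpa using hr' a trivial
    refine hprime.ne_top ((Ideal.eq_top_iff_one _).mpr ?_)
    simpa using sub_mem (hle hrV) hr
  rw [moduleDepth, if_neg hne]
  apply le_antisymm
  · refine iSup_le fun ⟨rs, hrs, hreg⟩ ↦ ?_
    have h := (length_le_ringKrullDim_quotient rs M _ _ hV hle hrs hreg.1).trans
      (ringKrullDim_quotient_span_X_image_le K (V : Set σ))
    have hcard : Nat.card ((V : Set σ)ᶜ : Set σ) = Fintype.card σ - V.card := by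
      classical
      rw [← Finset.coe_compl, Nat.card_coe_set_eq, Set.ncard_coe_finset, Finset.card_compl]
    rw [hcard] at h
    exact_mod_cast h
  · set l := (Finset.univ : Finset σ).toList with hl
    have hset : {i | i ∈ l} = Set.univ := by ext; simp [hl]
    have hlen : l.length = Fintype.card σ := by rw [hl, Finset.length_toList, Finset.card_univ]
    have hofl : Ideal.ofList (l.map (X : σ → MvPolynomial σ K)) = irrelevantIdeal σ K := by
      rw [ofList_map_X, hset, h𝔪]
    have hext : ∀ i < Fintype.card σ - V.card, Subsingleton (Ext (ModuleCat.of (MvPolynomial σ K)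
        (MvPolynomial σ K ⧸ irrelevantIdeal σ K)) (ModuleCat.of (MvPolynomial σ K) M) i) := by
      intro i hi
      rw [← hofl]
      exact subsingleton_ext_quotient_of_hasProjectiveDimensionLT _
        (isWeaklyRegular_map_X K l (Finset.nodup_toList _)) (hofl ▸ hprime.ne_top) V.card _ hM i
        (by rw [List.length_map, hlen]; omega)
    have hfin : Module.Finite (MvPolynomial σ K) (ModuleCat.of (MvPolynomial σ K)
        (MvPolynomial σ K ⧸ irrelevantIdeal σ K)) :=
      inferInstanceAs (Module.Finite _ (MvPolynomial σ K ⧸ irrelevantIdeal σ K))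
    have hfin' : Module.Finite (MvPolynomial σ K) (ModuleCat.of (MvPolynomial σ K) M) :=
      inferInstanceAs (Module.Finite _ M)
    obtain ⟨rs, hlen, hmem, hreg⟩ := ModuleCat.exists_isRegular_of_exists_subsingleton_ext
      (irrelevantIdeal σ K) _ (ModuleCat.of (MvPolynomial σ K) M) hne.lt_top
      (ModuleCat.of (MvPolynomial σ K) (MvPolynomial σ K ⧸ irrelevantIdeal σ K))
      (by
        change Module.support _ (MvPolynomial σ K ⧸ irrelevantIdeal σ K) = _
        rw [Module.support_eq_zeroLocus, Ideal.annihilator_quotient]) hext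
    rw [← hlen]
    exact le_iSup (fun rs : {rs : List (MvPolynomial σ K) //
      (∀ r ∈ rs, r ∈ irrelevantIdeal σ K) ∧ IsRegular M rs} ↦ (rs.1.length : ℕ∞))
      ⟨rs, hmem, hreg⟩

/-- If `pd R/I ≤ s + 1` and `R/I` has an associated prime generated by `s + 1` of the variables,
then `pd I = s`. -/
theorem projectiveDimension_ideal_of_mem_associatedPrimes {σ : Type v} [Finite σ] {K : Type u}
    [Field K] (I : Ideal (MvPolynomial σ K)) (V : Finset σ)
    (hV : Ideal.span (X '' (V : Set σ) : Set (MvPolynomial σ K)) ∈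
      associatedPrimes (MvPolynomial σ K) (MvPolynomial σ K ⧸ I)) (s : ℕ) (hs : V.card = s + 1)
    (hI : HasProjectiveDimensionLT
      (ModuleCat.of (MvPolynomial σ K) (MvPolynomial σ K ⧸ I)) (s + 2)) :
    projectiveDimension (ModuleCat.of (MvPolynomial σ K) I) = s := by
  let S : ShortComplex (ModuleCat.{max u v} (MvPolynomial σ K)) :=
    ModuleCat.shortComplexOfCompEqZero I.subtype I.mkQ
      (LinearMap.exact_subtype_mkQ I).linearMap_comp_eq_zero
  have hS : S.ShortExact :=
    { exact := ModuleCat.shortComplex_exact _ (LinearMap.exact_subtype_mkQ I)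
      mono_f := (ModuleCat.mono_iff_injective _).mpr I.injective_subtype
      epi_g := (ModuleCat.epi_iff_surjective _).mpr I.mkQ_surjective }
  have hproj : Projective S.X₂ :=
    inferInstanceAs (Projective (ModuleCat.of (MvPolynomial σ K) (MvPolynomial σ K)))
  apply le_antisymm
  · rw [projectiveDimension_le_iff]
    exact (hS.hasProjectiveDimensionLT_X₃_iff s hproj).mp hI
  · rw [projectiveDimension_ge_iff]
    intro h
    refine not_hasProjectiveDimensionLT_of_mem_associatedPrimes _ V hV ?_
    rw [hs]
    exact hS.hasProjectiveDimensionLT_X₃ s h (hasProjectiveDimensionLT_of_ge _ 1 _ (by omega))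

end AssociatedVariablePrime

/-! ### Squarefree monomials of fixed degree -/

section SquarefreeMonomials

variable {n m : ℕ}

lemma exists_lt_apply_of_degree_lt {a b : Fin n →₀ ℕ} (h : a.degree < b.degree) :
    ∃ i, a i < b i := by
  by_contra! hle
  exact absurd (Finsupp.degree_mono (show b ≤ a from hle)) h.not_ge

lemma exists_lt_apply_of_degree_eq {a b : Fin n →₀ ℕ} (h : a.degree = b.degree) (hne : b ≠ a) :
    ∃ i, a i < b i := by
  by_contra! hle
  refine hne (Finsupp.ext fun i ↦ (hle i).antisymm ?_)
  rw [Finsupp.degree_eq_sum, Finsupp.degree_eq_sum] at h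
  exact ((Finset.sum_eq_sum_iff_of_le fun i _ ↦ hle i).mp h.symm i (Finset.mem_univ i)).ge

lemma card_filter_eq_zero_add_degree {a : Fin n →₀ ℕ} (ha : IsSquarefreeMonomial a) :
    (Finset.univ.filter fun i ↦ a i = 0).card + a.degree = n := by
  rw [Finsupp.degree_eq_sum, Finset.card_filter, ← Finset.sum_add_distrib]
  conv_rhs => rw [← Fintype.card_fin n, ← Finset.card_univ, Finset.card_eq_sum_ones]
  refine Finset.sum_congr rfl fun i _ ↦ ?_
  have := ha i
  split_ifs <;> omega

lemma exists_eq_add_single_of_le {a b : Fin n →₀ ℕ} (hle : a ≤ b) (h : a.degree + 1 = b.degree) :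
    ∃ k, b = a + Finsupp.single k 1 := by
  obtain ⟨c, rfl⟩ := exists_add_of_le hle
  rw [map_add] at h
  have hc : c.degree = 1 := by omega
  have hc0 : c ≠ 0 := by rintro rfl; simp at hc
  obtain ⟨k, hk⟩ := Finsupp.ne_iff.mp hc0
  have hk' : Finsupp.single k 1 ≤ c := by
    rw [Finsupp.single_le_iff]; exact Nat.one_le_iff_ne_zero.mpr hk
  obtain ⟨e, rfl⟩ := exists_add_of_le hk'
  rw [map_add, Finsupp.degree_single] at hc
  have he : e = 0 := (Finsupp.degree_eq_zero_iff e).mp (by omega)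
  exact ⟨k, by rw [he, add_zero]⟩

lemma degree_sub_single_add_one {a : Fin n →₀ ℕ} {k : Fin n} (h : Finsupp.single k 1 ≤ a) :
    (a - Finsupp.single k 1).degree + 1 = a.degree := by
  conv_rhs => rw [← tsub_add_cancel_of_le h, map_add, Finsupp.degree_single]

lemma IsSquarefreeMonomial.mono {a b : Fin n →₀ ℕ} (hb : IsSquarefreeMonomial b) (h : a ≤ b) :
    IsSquarefreeMonomial a := fun i ↦ (h i).trans (hb i)

lemma sumElim_le_iff {α β : Type*} {a a' : α →₀ ℕ} {b b' : β →₀ ℕ} :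
    Finsupp.sumElim a b ≤ Finsupp.sumElim a' b' ↔ a ≤ a' ∧ b ≤ b' := by
  simp only [Finsupp.le_def, Sum.forall, Finsupp.sumElim_inl, Finsupp.sumElim_inr]

lemma single_inl_add_sumElim {α β : Type*} (i : α) (a : α →₀ ℕ) (b : β →₀ ℕ) :
    Finsupp.single (Sum.inl i) 1 + Finsupp.sumElim a b =
      Finsupp.sumElim (a + Finsupp.single i 1) b := by
  classical
  ext (j | j) <;> simp [Finsupp.single_apply, add_comm]

lemma single_inr_add_sumElim {α β : Type*} (i : β) (a : α →₀ ℕ) (b : β →₀ ℕ) :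
    Finsupp.single (Sum.inr i) 1 + Finsupp.sumElim a b =
      Finsupp.sumElim a (b + Finsupp.single i 1) := by
  classical
  ext (j | j) <;> simp [Finsupp.single_apply, add_comm]

lemma isSquarefreeMonomial_add_single {a : Fin n →₀ ℕ} (ha : IsSquarefreeMonomial a) {i : Fin n}
    (hi : a i = 0) : IsSquarefreeMonomial (a + Finsupp.single i 1) := by
  intro k
  rw [Finsupp.add_apply, Finsupp.single_apply]
  split_ifs with h
  · subst h; omega
  · have := ha k; omega

/-- The squarefree monomials of degree `d`. -/
def squarefreeMonomials (n d : ℕ) : Set (Fin n →₀ ℕ) := {a | a.degree = d ∧ IsSquarefreeMonomial a}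

lemma finite_squarefreeMonomials (n d : ℕ) : (squarefreeMonomials n d).Finite :=
  (Finsupp.finite_of_degree_eq d).subset fun _ h ↦ h.1

/-- The squarefree Veronese ideal, extended by the variables indexed by `Fin m`, has linear
quotients with respect to the lexicographic order. -/
lemma hasProjectiveDimensionLT_quotient_squarefreeMonomials (K : Type u) [Field K] (d : ℕ) :
    HasProjectiveDimensionLT (ModuleCat.of (MvPolynomial (Fin n ⊕ Fin m) K)
      (MvPolynomial (Fin n ⊕ Fin m) K ⧸ monomialSpan K
        ((fun a ↦ Finsupp.sumElim a (0 : Fin m →₀ ℕ)) '' squarefreeMonomials n d)))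
      (n - d + 2) := by
  have hbot : monomialSpan K (∅ : Set (Fin n ⊕ Fin m →₀ ℕ)) = ⊥ := by simp [monomialSpan]
  have h₀ : HasProjectiveDimensionLT (ModuleCat.of (MvPolynomial (Fin n ⊕ Fin m) K)
      (MvPolynomial (Fin n ⊕ Fin m) K ⧸ monomialSpan K (∅ : Set (Fin n ⊕ Fin m →₀ ℕ))))
      (n - d + 2) := by
    rw [hbot]
    have e := (Submodule.quotEquivOfEqBot
      (⊥ : Ideal (MvPolynomial (Fin n ⊕ Fin m) K)) rfl).symm.toModuleIso
    have := hasProjectiveDimensionLT_of_ge (ModuleCat.of (MvPolynomial (Fin n ⊕ Fin m) K)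
      (MvPolynomial (Fin n ⊕ Fin m) K)) 1 (n - d + 2) (by omega)
    exact hasProjectiveDimensionLT_of_iso e _
  have := hasProjectiveDimensionLT_quotient_monomialSpan_of_linearQuotients ∅ (n - d) h₀
    (finite_squarefreeMonomials n d).toFinset (fun a ↦ Finsupp.sumElim a (0 : Fin m →₀ ℕ)) toLex ?_
  · rwa [Set.empty_union, Set.Finite.coe_toFinset] at this
  intro a ha
  rw [Set.Finite.mem_toFinset] at ha
  obtain ⟨had, hasq⟩ := ha
  -- Replacing `x_k` by a later `x_i ∤ a` gives a lexicographically smaller generator dividing `x_i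
  -- a`. At most `n - d` variables avoid `a`.
  refine ⟨(Finset.univ.filter fun i ↦ a i = 0 ∧ ∃ k < i, a k ≠ 0).map .inl, ?_, ?_, ?_, ?_⟩
  · rw [Finset.card_map]
    have h1 := card_filter_eq_zero_add_degree hasq
    have h2 := Finset.card_le_card (Finset.monotone_filter_right Finset.univ
      (fun i _ h ↦ h.1 : ∀ i ∈ Finset.univ, (a i = 0 ∧ ∃ k < i, a k ≠ 0) → a i = 0))
    omega
  · intro v hv
    simp only [Finset.mem_map, Finset.mem_filter, Finset.mem_univ, true_and] at hv
    obtain ⟨i, ⟨hi, k, hki, hk⟩, rfl⟩ := hv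
    right
    have hle : Finsupp.single k 1 ≤ a := by
      rw [Finsupp.single_le_iff]; exact Nat.one_le_iff_ne_zero.mpr hk
    refine ⟨a - Finsupp.single k 1 + Finsupp.single i 1, ?_, ?_, ?_⟩
    · rw [Set.Finite.mem_toFinset]
      refine ⟨?_, isSquarefreeMonomial_add_single (hasq.mono tsub_le_self) ?_⟩
      · rw [map_add, Finsupp.degree_single, degree_sub_single_add_one hle, had]
      · rw [Finsupp.tsub_apply, hi, zero_tsub]
    · rw [Finsupp.Lex.lt_iff]
      refine ⟨k, fun j hj ↦ ?_, ?_⟩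
      · simp [hj.ne', (hj.trans hki).ne']
      · simp [hki.ne']
        omega
    · rw [Function.Embedding.inl_apply, single_inl_add_sumElim, sumElim_le_iff]
      exact ⟨add_le_add_left tsub_le_self _, le_rfl⟩
  · simp
  · intro b hb hba hne
    rw [Set.Finite.mem_toFinset] at hb
    have hlt : toLex b < toLex a := lt_of_le_of_ne hba fun h ↦ hne (toLex.injective h)
    obtain ⟨k, hk, hk'⟩ := Finsupp.Lex.lt_iff.mp hlt
    change ∀ j < k, b j = a j at hk
    change b k < a k at hk'
    obtain ⟨i, hi⟩ := exists_lt_apply_of_degree_eq (had.trans hb.1.symm) hne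
    have hb1 := hb.2 i
    -- `k` is the first place where `a` and `b` differ, and there `b` is smaller.
    have hki : k < i := by
      by_contra! h
      rcases h.lt_or_eq with h | rfl
      · exact absurd (hk i h) hi.ne'
      · omega
    refine ⟨Sum.inl i, ?_, by simpa using hi⟩
    simp only [Finset.mem_map, Finset.mem_filter, Finset.mem_univ, true_and]
    exact ⟨i, ⟨by omega, k, hki, by omega⟩, rfl⟩

end SquarefreeMonomials

/-! ### Linear quotients and an associated prime of the `*`-linearization -/

section StarLinearization

variable {n m : ℕ}

/-- The pairs `(u, j)` for which `u y_j` is a generator of the last part of the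
`*`-linearization. -/
def lastPairs (f : Fin m → (Fin n →₀ ℕ)) : Set ((Fin n →₀ ℕ) × Fin m) :=
  {q | ∃ k, Finsupp.single k 1 ≤ f q.2 ∧ q.1 = f q.2 - Finsupp.single k 1}

lemma finite_lastPairs (f : Fin m → (Fin n →₀ ℕ)) : (lastPairs f).Finite := by
  refine (Set.finite_range fun p : Fin n × Fin m ↦
    (f p.2 - Finsupp.single p.1 1, p.2)).subset ?_
  rintro ⟨u, j⟩ ⟨k, -, hk⟩
  exact ⟨(k, j), Prod.ext hk.symm rfl⟩

/-- The exponent vector of `u y_j`. -/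
noncomputable def pairExponent (q : (Fin n →₀ ℕ) × Fin m) : Fin n ⊕ Fin m →₀ ℕ :=
  Finsupp.sumElim q.1 (Finsupp.single q.2 1)

lemma starLinearization_eq_monomialSpan (K : Type u) [Field K] {d : ℕ} {f : Fin m → (Fin n →₀ ℕ)}
    (hmax : maxExponent f = 1) :
    starLinearization K d f = monomialSpan K
      ((fun a ↦ Finsupp.sumElim a (0 : Fin m →₀ ℕ)) '' squarefreeMonomials n d ∪
        pairExponent '' lastPairs f) := by
  rw [starLinearization, completePart, lastPart, monomialSpan, ← Ideal.span_union, hmax]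
  congr 1
  rw [Set.image_union, Set.image_image, Set.image_image]
  congr 1
  · ext p
    constructor
    · rintro ⟨a, had, ha, rfl⟩
      exact ⟨a, ⟨had, ha⟩, rfl⟩
    · rintro ⟨a, ⟨had, ha⟩, rfl⟩
      exact ⟨a, had, ha, rfl⟩
  · ext p
    constructor
    · rintro ⟨j, k, hk, rfl⟩
      exact ⟨(f j - Finsupp.single k 1, j), ⟨k, hk, rfl⟩, rfl⟩
    · rintro ⟨⟨u, j⟩, ⟨k, hk, hu⟩, rfl⟩
      refine ⟨j, k, hk, ?_⟩
      change u = _ at hu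
      rw [hu]
      rfl

variable {d : ℕ} {f : Fin m → (Fin n →₀ ℕ)}

lemma degree_of_mem_lastPairs (hdeg : ∀ j, (f j).degree = d) {q : (Fin n →₀ ℕ) × Fin m}
    (hq : q ∈ lastPairs f) : q.1.degree + 1 = d := by
  obtain ⟨k, hk, hu⟩ := hq
  rw [hu, degree_sub_single_add_one hk, hdeg]

lemma le_of_mem_lastPairs {q : (Fin n →₀ ℕ) × Fin m} (hq : q ∈ lastPairs f) : q.1 ≤ f q.2 := by
  obtain ⟨k, hk, hu⟩ := hq
  rw [hu]
  exact tsub_le_self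

lemma mem_lastPairs_of_le (hdeg : ∀ j, (f j).degree = d) {u : Fin n →₀ ℕ} {j : Fin m}
    (hu : u.degree + 1 = d) (hle : u ≤ f j) : (u, j) ∈ lastPairs f := by
  obtain ⟨k, hk⟩ := exists_eq_add_single_of_le hle (hu.trans (hdeg j).symm)
  refine ⟨k, ?_, ?_⟩
  · rw [hk]; exact le_add_self
  · rw [hk, add_tsub_cancel_right]

lemma hasProjectiveDimensionLT_quotient_starLinearization (K : Type u) [Field K]
    (hmax : maxExponent f = 1) (hdeg : ∀ j, (f j).degree = d)
    (hsq : ∀ j, IsSquarefreeMonomial (f j)) (hdn : d ≤ n) {N : ℕ}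
    (hN : ∀ u : Fin n →₀ ℕ, IsSquarefreeMonomial u → u.degree + 1 = d → (∃ j, u ≤ f j) →
      (Finset.univ.filter fun j ↦ u ≤ f j).card ≤ N) :
    HasProjectiveDimensionLT (ModuleCat.of (MvPolynomial (Fin n ⊕ Fin m) K)
      (MvPolynomial (Fin n ⊕ Fin m) K ⧸ starLinearization K d f)) (n - d + N + 2) := by
  classical
  rw [starLinearization_eq_monomialSpan K hmax]
  have h₀ : HasProjectiveDimensionLT (ModuleCat.of (MvPolynomial (Fin n ⊕ Fin m) K)
      (MvPolynomial (Fin n ⊕ Fin m) K ⧸ monomialSpan K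
        ((fun a ↦ Finsupp.sumElim a (0 : Fin m →₀ ℕ)) '' squarefreeMonomials n d)))
      (n - d + N + 2) :=
    have := hasProjectiveDimensionLT_quotient_squarefreeMonomials (n := n) (m := m) K d
    hasProjectiveDimensionLT_of_ge _ (n - d + 2) _ (by omega)
  have := hasProjectiveDimensionLT_quotient_monomialSpan_of_linearQuotients _ (n - d + N) h₀
    (finite_lastPairs f).toFinset pairExponent Prod.snd ?_
  · rwa [Set.Finite.coe_toFinset] at this
  rintro ⟨u, j⟩ hq
  rw [Set.Finite.mem_toFinset] at hq
  have hud := degree_of_mem_lastPairs hdeg hq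
  have huj := le_of_mem_lastPairs hq
  dsimp only at hud huj
  have husq := (hsq j).mono huj
  -- `x_i u` is a squarefree monomial of degree `d`, and `u y_i` is an earlier generator. Two
  -- generators with the same `y_j` have distinct edges of equal degree, so an `x`-variable
  -- separates them.
  refine ⟨(Finset.univ.filter fun i ↦ u i = 0).disjSum
    (Finset.univ.filter fun i ↦ i < j ∧ u ≤ f i), ?_, ?_, ?_, ?_⟩
  · rw [Finset.card_disjSum]
    have h1 := card_filter_eq_zero_add_degree husq
    have h2 := hN u husq hud ⟨j, huj⟩
    -- The strict inequality, as `j` itself is left out, absorbs the `+ 1` in the `n - d + 1`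
    -- variables avoiding `u`.
    have h3 : (Finset.univ.filter fun i ↦ i < j ∧ u ≤ f i).card <
        (Finset.univ.filter fun i ↦ u ≤ f i).card := by
      refine Finset.card_lt_card (Finset.ssubset_iff_subset_ne.mpr ⟨?_, fun h ↦ ?_⟩)
      · intro i hi
        simp only [Finset.mem_filter, Finset.mem_univ, true_and] at hi ⊢
        exact hi.2
      · have hj : j ∈ Finset.univ.filter fun i ↦ u ≤ f i := by simpa using huj
        rw [← h] at hj
        simp at hj
    omega
  · rintro (i | i) hv
    · left
      rw [Finset.inl_mem_disjSum, Finset.mem_filter] at hv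
      refine ⟨_, ⟨u + Finsupp.single i 1, ⟨?_, isSquarefreeMonomial_add_single husq hv.2⟩, rfl⟩, ?_⟩
      · rw [map_add, Finsupp.degree_single, hud]
      · rw [pairExponent, single_inl_add_sumElim, sumElim_le_iff]
        exact ⟨le_rfl, zero_le⟩
    · right
      rw [Finset.inr_mem_disjSum, Finset.mem_filter] at hv
      refine ⟨(u, i), ?_, hv.2.1, ?_⟩
      · rw [Set.Finite.mem_toFinset]
        exact mem_lastPairs_of_le hdeg hud hv.2.2
      · rw [pairExponent, pairExponent, single_inr_add_sumElim, sumElim_le_iff]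
        exact ⟨le_rfl, le_add_self⟩
  · rintro _ ⟨a, ⟨had, hasq⟩, rfl⟩
    obtain ⟨i, hi⟩ := exists_lt_apply_of_degree_lt (a := u) (b := a) (by omega)
    have := hasq i
    refine ⟨Sum.inl i, ?_, by simpa [pairExponent] using hi⟩
    rw [Finset.inl_mem_disjSum, Finset.mem_filter]
    exact ⟨Finset.mem_univ _, by omega⟩
  · rintro ⟨w, i⟩ hw hij hne
    rw [Set.Finite.mem_toFinset] at hw
    have hwd := degree_of_mem_lastPairs hdeg hw
    have hwi := le_of_mem_lastPairs hw
    dsimp only at hwd hwi hij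
    by_cases hwu : w = u
    · subst hwu
      have hij' : i < j := lt_of_le_of_ne hij fun h ↦ hne (h ▸ rfl)
      refine ⟨Sum.inr i, ?_, by simp [pairExponent, hij'.ne']⟩
      rw [Finset.inr_mem_disjSum, Finset.mem_filter]
      exact ⟨Finset.mem_univ _, hij', hwi⟩
    · obtain ⟨k, hk⟩ := exists_lt_apply_of_degree_eq (a := u) (b := w) (by omega) hwu
      have := (hsq i).mono hwi k
      refine ⟨Sum.inl k, ?_, by simpa [pairExponent] using hk⟩
      rw [Finset.inl_mem_disjSum, Finset.mem_filter]
      exact ⟨Finset.mem_univ _, by omega⟩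

/-- The variables that generate the colon ideal of the `*`-linearization by an edge `u`. -/
def edgeVariables (f : Fin m → (Fin n →₀ ℕ)) (u : Fin n →₀ ℕ) : Finset (Fin n ⊕ Fin m) :=
  (Finset.univ.filter fun i ↦ u i = 0).disjSum (Finset.univ.filter fun j ↦ u ≤ f j)

/-- The prime is the annihilator of the class of the monomial `u` itself. -/
lemma span_edgeVariables_mem_associatedPrimes (K : Type u) [Field K]
    (hmax : maxExponent f = 1) (hdeg : ∀ j, (f j).degree = d)
    (hsq : ∀ j, IsSquarefreeMonomial (f j)) {u : Fin n →₀ ℕ} (husq : IsSquarefreeMonomial u)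
    (hud : u.degree + 1 = d) :
    Ideal.span (X '' (edgeVariables f u : Set (Fin n ⊕ Fin m)) :
        Set (MvPolynomial (Fin n ⊕ Fin m) K)) ∈
      associatedPrimes (MvPolynomial (Fin n ⊕ Fin m) K)
        (MvPolynomial (Fin n ⊕ Fin m) K ⧸ starLinearization K d f) := by
  rw [AssociatedPrimes.mem_iff, isAssociatedPrime_iff]
  refine ⟨isPrime_span_X_image K _,
    Submodule.Quotient.mk (monomial (Finsupp.sumElim u 0) (1 : K)), ?_⟩
  ext p
  rw [Submodule.mem_colon_singleton, ← Submodule.Quotient.mk_smul, Submodule.mem_bot,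
    Submodule.Quotient.mk_eq_zero, smul_eq_mul, starLinearization_eq_monomialSpan K hmax,
    mul_monomial_mem_monomialSpan_iff_mem_span_X]
  · rintro (i | j) hv
    · rw [edgeVariables, Finset.mem_coe, Finset.inl_mem_disjSum, Finset.mem_filter] at hv
      refine ⟨_, .inl ⟨u + Finsupp.single i 1,
        ⟨?_, isSquarefreeMonomial_add_single husq hv.2⟩, rfl⟩, ?_⟩
      · rw [map_add, Finsupp.degree_single, hud]
      · rw [single_inl_add_sumElim]
    · rw [edgeVariables, Finset.mem_coe, Finset.inr_mem_disjSum, Finset.mem_filter] at hv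
      refine ⟨_, .inr ⟨(u, j), mem_lastPairs_of_le hdeg hud hv.2, rfl⟩, ?_⟩
      rw [pairExponent, single_inr_add_sumElim, zero_add]
  · rintro _ (⟨a, ⟨had, hasq⟩, rfl⟩ | ⟨⟨w, j⟩, hw, rfl⟩)
    · obtain ⟨i, hi⟩ := exists_lt_apply_of_degree_lt (a := u) (b := a) (by omega)
      have := hasq i
      refine ⟨Sum.inl i, ?_, by simpa using hi⟩
      rw [edgeVariables, Finset.mem_coe, Finset.inl_mem_disjSum, Finset.mem_filter]
      exact ⟨Finset.mem_univ _, by omega⟩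
    · have hwd := degree_of_mem_lastPairs hdeg hw
      have hwj := le_of_mem_lastPairs hw
      dsimp only at hwd hwj
      by_cases hwu : w = u
      · subst hwu
        refine ⟨Sum.inr j, ?_, by simp [pairExponent]⟩
        rw [edgeVariables, Finset.mem_coe, Finset.inr_mem_disjSum, Finset.mem_filter]
        exact ⟨Finset.mem_univ _, hwj⟩
      · obtain ⟨k, hk⟩ := exists_lt_apply_of_degree_eq (a := u) (b := w) (by omega) hwu
        have := (hsq j).mono hwj k
        refine ⟨Sum.inl k, ?_, by simpa [pairExponent] using hk⟩
        rw [edgeVariables, Finset.mem_coe, Finset.inl_mem_disjSum, Finset.mem_filter]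
        exact ⟨Finset.mem_univ _, by omega⟩

end StarLinearization

/-! ### Clusters and edges -/

section Clusters

variable {n m d : ℕ} {f : Fin m → (Fin n →₀ ℕ)}

lemma IsCluster.exists_card_le {j : ℕ} {C : Finset (Fin n →₀ ℕ)}
    (hC : IsCluster (Set.range f) d j C) :
    ∃ u, IsEdge (Set.range f) d u ∧ j ≤ (Finset.univ.filter fun j ↦ u ≤ f j).card := by
  classical
  obtain ⟨rfl, hCf, u, hu, hCu⟩ := hC
  refine ⟨u, hu, (Finset.card_le_card fun a ha ↦ ?_).trans
    (Finset.card_image_le (s := Finset.univ.filter fun j ↦ u ≤ f j) (f := f))⟩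
  obtain ⟨j, rfl⟩ := hCf a ha
  exact Finset.mem_image_of_mem f (by simpa using hCu _ ha)

lemma isCluster_image_filter (hf : Function.Injective f) {u : Fin n →₀ ℕ}
    (hu : IsEdge (Set.range f) d u) [DecidableEq (Fin n →₀ ℕ)] :
    IsCluster (Set.range f) d (Finset.univ.filter fun j ↦ u ≤ f j).card
      ((Finset.univ.filter fun j ↦ u ≤ f j).image f) := by
  refine ⟨Finset.card_image_of_injective _ hf, fun a ha ↦ ?_, u, hu, fun a ha ↦ ?_⟩
  all_goals
    obtain ⟨j, hj, rfl⟩ := Finset.mem_image.mp ha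
  · exact ⟨j, rfl⟩
  · simpa using hj

/-- Finiteness matters here: `ncard` is `0` on infinite sets. -/
lemma numMaximalClusters_ne_zero_iff {j : ℕ} :
    numMaximalClusters (Set.range f) d j ≠ 0 ↔ ∃ C, IsMaximalCluster (Set.range f) d j C := by
  classical
  have hfin : {C | IsMaximalCluster (Set.range f) d j C}.Finite := by
    refine ((Finset.univ.image f).powerset.finite_toSet).subset fun C hC ↦ ?_
    rw [Finset.mem_coe, Finset.mem_powerset]
    intro a ha
    obtain ⟨i, rfl⟩ := hC.1.2.1 a ha
    exact Finset.mem_image_of_mem f (Finset.mem_univ i)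
  rw [numMaximalClusters, Ne, Set.ncard_eq_zero hfin, ← Ne, ← Set.nonempty_iff_ne_empty]
  rfl

/-- The largest size of a maximal cluster is the largest number of the `f_j` that are divided by a
same edge. -/
lemma exists_isGreatest_numMaximalClusters (hf : Function.Injective f)
    (hedge : ∃ u, IsEdge (Set.range f) d u) :
    ∃ N, IsGreatest {j | numMaximalClusters (Set.range f) d j ≠ 0} N ∧
      (∃ u, IsEdge (Set.range f) d u ∧ (Finset.univ.filter fun j ↦ u ≤ f j).card = N) ∧
      ∀ u, IsEdge (Set.range f) d u → (Finset.univ.filter fun j ↦ u ≤ f j).card ≤ N := by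
  classical
  let T : Set ℕ := {c | ∃ u, IsEdge (Set.range f) d u ∧
    (Finset.univ.filter fun j ↦ u ≤ f j).card = c}
  have hbdd : BddAbove T := ⟨m, by
    rintro _ ⟨u, -, rfl⟩
    exact (Finset.card_le_univ _).trans_eq (Fintype.card_fin m)⟩
  have hne : T.Nonempty := hedge.imp' _ fun u hu ↦ ⟨u, hu, rfl⟩
  obtain ⟨u, hu, huN⟩ := Nat.sSup_mem hne hbdd
  have hle : ∀ u, IsEdge (Set.range f) d u →
      (Finset.univ.filter fun j ↦ u ≤ f j).card ≤ sSup T := fun u hu ↦ le_csSup hbdd ⟨u, hu, rfl⟩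
  refine ⟨sSup T, ⟨?_, fun j hj ↦ ?_⟩, ⟨u, hu, huN⟩, hle⟩
  · refine numMaximalClusters_ne_zero_iff.mpr
      ⟨_, huN ▸ isCluster_image_filter hf hu, fun ⟨C', hC', _⟩ ↦ ?_⟩
    obtain ⟨u', hu', hle'⟩ := hC'.exists_card_le
    -- A larger cluster would give an edge dividing more than the maximal number of generators.
    exact absurd (hle'.trans (hle u' hu')) (by omega)
  · obtain ⟨C, hC, -⟩ := numMaximalClusters_ne_zero_iff.mp hj
    obtain ⟨u', hu', hle'⟩ := hC.exists_card_le
    exact hle'.trans (hle u' hu')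

end Clusters

/-! ### The main theorem -/

lemma minimalMonomialGenerators_nonempty {K : Type u} [Field K] {n : ℕ}
    {I : Ideal (MvPolynomial (Fin n) K)} (hI : IsMonomialIdeal I) (hI0 : I ≠ ⊥) :
    (minimalMonomialGenerators I).Nonempty := by
  have hex : ∃ a : Fin n →₀ ℕ, monomial a (1 : K) ∈ I := by
    by_contra! h
    apply hI0
    rw [← hI, Ideal.span_eq_bot]
    rintro _ ⟨a, rfl, ha⟩
    exact absurd ha (h a)
  obtain ⟨a, ha⟩ := hex
  obtain ⟨b, -, hb⟩ := exists_minimal_le_of_wellFoundedLT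
    (fun b : Fin n →₀ ℕ ↦ monomial b (1 : K) ∈ I) a ha
  exact ⟨b, hb⟩

lemma maxExponent_eq_one {n m : ℕ} {f : Fin m → (Fin n →₀ ℕ)}
    (hsq : ∀ j, IsSquarefreeMonomial (f j)) {j : Fin m} (hj : f j ≠ 0) : maxExponent f = 1 := by
  apply le_antisymm
  · exact Finset.sup_le fun j _ ↦ Finset.sup_le fun i _ ↦ hsq j i
  · obtain ⟨i, hi⟩ := Finsupp.ne_iff.mp hj
    exact (Nat.one_le_iff_ne_zero.mpr hi).trans ((Finset.le_sup (f := fun i ↦ f j i)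
      (Finset.mem_univ i)).trans (Finset.le_sup
        (f := fun j ↦ Finset.univ.sup fun i ↦ f j i) (Finset.mem_univ j)))

theorem mainTheorem7 (K : Type u) [Field K] (n m d : ℕ) (I : Ideal (MvPolynomial (Fin n) K))
    (hI : IsSquarefreeMonomialIdeal I) (hI0 : I ≠ ⊥)
    (hd : 1 ≤ d) (hId : IsEquigenerated I d)
    (f : Fin m → (Fin n →₀ ℕ)) (hf : Function.Injective f)
    (hfG : Set.range f = minimalMonomialGenerators I) :
    ∃ N : ℕ, IsGreatest {j : ℕ | numMaximalClusters (minimalMonomialGenerators I) d j ≠ 0} N ∧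
      (∃ p : ℕ, (p : ℤ) = (n : ℤ) - d + N ∧
        projectiveDimension
          (ModuleCat.of (MvPolynomial (Fin n ⊕ Fin m) K) (starLinearization K d f)) = p) ∧
      (∃ e : ℕ, (e : ℤ) = (m : ℤ) + d - N - 1 ∧
        moduleDepth (irrelevantIdeal (Fin n ⊕ Fin m) K)
          (MvPolynomial (Fin n ⊕ Fin m) K ⧸ starLinearization K d f) = e) := by
  have hmem : ∀ j, f j ∈ minimalMonomialGenerators I := fun j ↦ hfG ▸ ⟨j, rfl⟩
  have hdeg : ∀ j, (f j).degree = d := fun j ↦ hId _ (hmem j)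
  have hsq : ∀ j, IsSquarefreeMonomial (f j) := fun j ↦ hI.2 _ (hmem j)
  obtain ⟨_, hgen⟩ := minimalMonomialGenerators_nonempty hI.1 hI0
  rw [← hfG] at hgen ⊢
  obtain ⟨j₀, rfl⟩ := hgen
  have hj₀ : f j₀ ≠ 0 := by
    intro h
    have := hdeg j₀
    rw [h, map_zero] at this
    omega
  have hmax := maxExponent_eq_one hsq hj₀
  -- This makes the truncated difference `n - d` a genuine one.
  have hdn : d ≤ n := by
    have := card_filter_eq_zero_add_degree (hsq j₀)
    rw [hdeg] at this
    omega
  have hedge : ∃ u, IsEdge (Set.range f) d u := by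
    obtain ⟨k, hk⟩ := Finsupp.ne_iff.mp hj₀
    have hle : Finsupp.single k 1 ≤ f j₀ := by
      rw [Finsupp.single_le_iff]; exact Nat.one_le_iff_ne_zero.mpr hk
    exact ⟨f j₀ - Finsupp.single k 1, (hsq j₀).mono tsub_le_self,
      (degree_sub_single_add_one hle).trans (hdeg j₀), f j₀, ⟨j₀, rfl⟩, tsub_le_self⟩
  obtain ⟨N, hN, ⟨u, ⟨husq, hud, -⟩, huN⟩, hle⟩ := exists_isGreatest_numMaximalClusters hf hedge
  have hpd := hasProjectiveDimensionLT_quotient_starLinearization K hmax hdeg hsq hdn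
    fun u hu hud ⟨j, hj⟩ ↦ hle u ⟨hu, hud, f j, ⟨j, rfl⟩, hj⟩
  have hass := span_edgeVariables_mem_associatedPrimes K hmax hdeg hsq husq hud
  have hcard : (edgeVariables f u).card = n - d + N + 1 := by
    have := card_filter_eq_zero_add_degree husq
    rw [edgeVariables, Finset.card_disjSum, huN]
    omega
  -- The edge variables are among the `n + m` variables, so the subtraction in the depth witness is
  -- not truncated.
  have hcard_le := Finset.card_le_univ (edgeVariables f u)
  rw [Fintype.card_sum, Fintype.card_fin, Fintype.card_fin, hcard] at hcard_le
  refine ⟨N, hN, ⟨n - d + N, by omega,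
    projectiveDimension_ideal_of_mem_associatedPrimes _ _ hass _ hcard hpd⟩,
    n + m - (n - d + N + 1), by omega, ?_⟩
  have := moduleDepth_irrelevantIdeal_of_mem_associatedPrimes _ (edgeVariables f u) hass
    (by rw [hcard]; exact hpd)
  rwa [Fintype.card_sum, Fintype.card_fin, Fintype.card_fin, hcard] at this
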